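/- Let $P$ and $Q$ be Borel probability measures on $\mathbb{R}^n$ with Euclidean norm $\|\cdot\|$, let $\Pi(P,Q)$ be the set of joint laws on $\mathbb{R}^n\times\mathbb{R}^n$ with first marginal $P$ and second marginal $Q$, and suppose that $$W_1(P,Q)=\inf_{\pi\in\Pi(P,Q)}\mathbb{E}_{(x,y)\sim\pi}\|x-y\|$$ is finite (as it is when $P$ and $Q$ have finite first moments). Let $\pi^*\in\Pi(P,Q)$ be an optimal plan, i.e. one that attains this infimum, and assume that $\pi^*(\{(x,y):x=y\})=0$. Let $D^*:\mathbb{R}^n\to\mathbb{R}$ be a differentiable optimal critic, i.e. a differentiable function that maximizes $$\mathbb{E}_{y\sim Q}[f(y)]-\mathbb{E}_{x\sim P}[f(x)]$$ among all 1-Lipschitz functions $f:\mathbb{R}^n\to\mathbb{R}$ that are integrable with respect to $P$ and $Q$ ($D^*$ being itself such a function; the integrability is automatic when $P$ and $Q$ have finite first moments). Then for $\pi^*$-almost every $(x,y)$, for every $t\in[0,1]$, with $x_t=tx+(1-t)y$, $$\nabla D^*(x_t)=\frac{y-x}{\|y-x\|}.$$ -/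

import Mathlib

open MeasureTheory
open scoped ENNReal NNReal

/-- `Π(P, Q)`: the joint laws on `ℝⁿ × ℝⁿ` with first marginal `P` and second marginal `Q`. -/
def transportPlans {n : ℕ} (P Q : Measure (EuclideanSpace ℝ (Fin n))) :
    Set (Measure (EuclideanSpace ℝ (Fin n) × EuclideanSpace ℝ (Fin n))) :=
  {π | π.map Prod.fst = P ∧ π.map Prod.snd = Q}

/-- The expected Euclidean transport cost `𝔼_{(x, y) ∼ π} ‖x - y‖`, with values in `[0, ∞]`. -/
noncomputable def transportCost {n : ℕ}
    (π : Measure (EuclideanSpace ℝ (Fin n) × EuclideanSpace ℝ (Fin n))) : ℝ≥0∞ :=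
  ∫⁻ z, ENNReal.ofReal ‖z.1 - z.2‖ ∂π

/-- The Wasserstein distance of first order, in its primal form. -/
noncomputable def wassersteinOne {n : ℕ} (P Q : Measure (EuclideanSpace ℝ (Fin n))) : ℝ≥0∞ :=
  ⨅ π ∈ transportPlans P Q, transportCost π

/-- `π` attains the infimum in the primal problem. -/
def IsOptimalPlan {n : ℕ} (P Q : Measure (EuclideanSpace ℝ (Fin n)))
    (π : Measure (EuclideanSpace ℝ (Fin n) × EuclideanSpace ℝ (Fin n))) : Prop :=
  π ∈ transportPlans P Q ∧ transportCost π = wassersteinOne P Q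

/-- The admissible functions of the Kantorovich-Rubinstein dual problem: the 1-Lipschitz functions
for which both expectations in the objective exist. The integrability is automatic when
`P` and `Q` have finite first moments. -/
def admissibleCritics {n : ℕ} (P Q : Measure (EuclideanSpace ℝ (Fin n))) :
    Set (EuclideanSpace ℝ (Fin n) → ℝ) :=
  {f | LipschitzWith 1 f ∧ Integrable f P ∧ Integrable f Q}

/-- The dual objective `𝔼_{y ∼ Q} f(y) - 𝔼_{x ∼ P} f(x)`. -/
noncomputable def criticObjective {n : ℕ} (P Q : Measure (EuclideanSpace ℝ (Fin n)))
    (f : EuclideanSpace ℝ (Fin n) → ℝ) : ℝ :=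
  (∫ y, f y ∂Q) - ∫ x, f x ∂P

/-- `D` is a maximizer of the Kantorovich-Rubinstein dual problem. -/
def IsOptimalCritic {n : ℕ} (P Q : Measure (EuclideanSpace ℝ (Fin n)))
    (D : EuclideanSpace ℝ (Fin n) → ℝ) : Prop :=
  D ∈ admissibleCritics P Q ∧
    ∀ f ∈ admissibleCritics P Q, criticObjective P Q f ≤ criticObjective P Q D

/-! The heart is strong duality. Rearranging small pieces of an optimal plan cannot lower its cost,
so its support is cyclically monotone (`IsOptimalPlan.isCyclicallyMonotone_support`). Rockafellar's
construction then yields a 1-Lipschitz potential with slope 1 across every pair of the support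
(`IsCyclicallyMonotone.exists_potential`). Its truncations are admissible, so the dual value of `D`
is at least the cost. As `D y - D x ≤ ‖x - y‖` pointwise, equality holds almost everywhere
(`IsOptimalCritic.ae_sub_eq_norm_sub`). For such a pair `D` is affine with slope 1 from `x` to `y`;
its gradient has norm at most 1, so equality in Cauchy-Schwarz determines it. -/

open Filter Topology ProbabilityTheory

/-! ### Rockafellar's potential of a cyclically monotone set -/

section Potential

variable {E : Type*} [NormedAddCommGroup E]

/-- Cyclical monotonicity with respect to the cost `‖x - y‖`. -/
def IsCyclicallyMonotone (S : Set (E × E)) : Prop :=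
  ∀ (N : ℕ) (p : Fin N → E × E) (σ : Equiv.Perm (Fin N)), (∀ i, p i ∈ S) →
    ∑ i, ‖(p i).1 - (p i).2‖ ≤ ∑ i, ‖(p i).1 - (p (σ i)).2‖

/-- The cost of travelling from `0` to `z` through the pairs `p 0, …, p N`, where each pair
`(x, y)` is crossed from `y` to `x` with the gain `‖x - y‖`. -/
def chainCost (p : ℕ → E × E) (N : ℕ) (z : E) : ℝ :=
  ‖(p 0).2‖ + ∑ i ∈ Finset.range N, (‖(p i).1 - (p (i + 1)).2‖ - ‖(p i).1 - (p i).2‖) +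
    (‖(p N).1 - z‖ - ‖(p N).1 - (p N).2‖)

lemma chainCost_le_add (p : ℕ → E × E) (N : ℕ) (z w : E) :
    chainCost p N z ≤ chainCost p N w + ‖z - w‖ := by
  have h : ‖(p N).1 - z‖ ≤ ‖(p N).1 - w‖ + ‖w - z‖ := by
    simpa [dist_eq_norm] using dist_triangle (p N).1 w z
  rw [norm_sub_rev w z] at h
  unfold chainCost
  linarith

/-- Minimizing over chains, this makes the potential at `w.1` lower than at `w.2` by at least `‖w.1
- w.2‖`. -/
lemma chainCost_append (p : ℕ → E × E) (N : ℕ) (w : E × E) :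
    chainCost (fun i => if i ≤ N then p i else w) (N + 1) w.1 =
      chainCost p N w.2 - ‖w.1 - w.2‖ := by
  unfold chainCost
  rw [Finset.sum_range_succ, Finset.sum_congr rfl (g := fun i =>
    ‖(p i).1 - (p (i + 1)).2‖ - ‖(p i).1 - (p i).2‖)]
  · simp
    ring
  · intro i hi
    have hi' := Finset.mem_range.mp hi
    simp [hi'.le, Nat.succ_le_of_lt hi']

/-- The cyclic shift closes the chain into a cycle, whose closing edge is bounded by a detour
through `z` and `0`. This keeps the infimum over chains finite. -/
lemma IsCyclicallyMonotone.neg_norm_le_chainCost {S : Set (E × E)} (hS : IsCyclicallyMonotone S)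
    {p : ℕ → E × E} (hp : ∀ i, p i ∈ S) (N : ℕ) (z : E) : -‖z‖ ≤ chainCost p N z := by
  have h := hS (N + 1) (fun i => p i) (finRotate (N + 1)) (fun i => hp i)
  rw [Fin.sum_univ_castSucc, Fin.sum_univ_castSucc (n := N)] at h
  simp only [finRotate_apply, Fin.coeSucc_eq_succ, Fin.val_castSucc, Fin.val_succ,
    Fin.val_last, Fin.last_add_one, Fin.val_zero] at h
  rw [Fin.sum_univ_eq_sum_range (fun i => ‖(p i).1 - (p i).2‖) N,
    Fin.sum_univ_eq_sum_range (fun i => ‖(p i).1 - (p (i + 1)).2‖) N] at h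
  have h1 : ‖(p N).1 - (p 0).2‖ ≤ ‖(p N).1 - z‖ + ‖z‖ + ‖(p 0).2‖ := by
    have := norm_sub_le ((p N).1 - z + z) (p 0).2
    rw [sub_add_cancel] at this
    have h2 := norm_add_le ((p N).1 - z) z
    rw [sub_add_cancel] at h2
    linarith
  unfold chainCost
  rw [Finset.sum_sub_distrib]
  linarith

/-- A nonempty cyclically monotone set lies in the contact set of a `1`-Lipschitz potential. -/
theorem IsCyclicallyMonotone.exists_potential {S : Set (E × E)} (hS : IsCyclicallyMonotone S)
    (hne : S.Nonempty) :
    ∃ φ : E → ℝ, LipschitzWith 1 φ ∧ ∀ z ∈ S, φ z.2 - φ z.1 = ‖z.1 - z.2‖ := by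
  obtain ⟨s, hs⟩ := hne
  let I := {p : ℕ → E × E // ∀ i, p i ∈ S} × ℕ
  have : Nonempty I := ⟨⟨fun _ => s, fun _ => hs⟩, 0⟩
  have hbdd (z : E) : BddBelow (Set.range fun c : I => chainCost c.1.1 c.2 z) := by
    refine ⟨-‖z‖, ?_⟩
    rintro _ ⟨c, rfl⟩
    exact hS.neg_norm_le_chainCost c.1.2 c.2 z
  let φ : E → ℝ := fun z => ⨅ c : I, chainCost c.1.1 c.2 z
  have hlip : LipschitzWith 1 φ := by
    refine LipschitzWith.of_le_add fun z w => ?_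
    rw [dist_eq_norm, ← sub_le_iff_le_add]
    refine le_ciInf fun c => ?_
    rw [sub_le_iff_le_add]
    exact (ciInf_le (hbdd z) c).trans (chainCost_le_add _ _ _ _)
  refine ⟨φ, hlip, fun z hz => le_antisymm ?_ ?_⟩
  · have h := hlip.dist_le_mul z.2 z.1
    rw [Real.dist_eq, dist_eq_norm, norm_sub_rev] at h
    simpa using (le_abs_self _).trans h
  · suffices φ z.1 + ‖z.1 - z.2‖ ≤ φ z.2 by linarith
    refine le_ciInf fun c => ?_
    have hq : ∀ i, (if i ≤ c.2 then c.1.1 i else z) ∈ S := by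
      intro i
      split_ifs
      · exact c.1.2 i
      · exact hz
    have h : φ z.1 ≤ _ := ciInf_le (hbdd z.1) (⟨⟨_, hq⟩, c.2 + 1⟩ : I)
    have h' := chainCost_append c.1.1 c.2 z
    simp only at h
    linarith

end Potential

/-! ### Gradients along segments of maximal slope -/

section Gradient

variable {F : Type*} [NormedAddCommGroup F] [InnerProductSpace ℝ F]

/-- The Lipschitz bounds on the two pieces add up to the attained total `‖y - x‖`, so both are
equalities. -/
lemma LipschitzWith.eq_on_segment_of_eq_norm_sub {D : F → ℝ} (hD : LipschitzWith 1 D)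
    {x y : F} (h : D y - D x = ‖y - x‖) {t : ℝ} (ht : t ∈ Set.Icc (0 : ℝ) 1) :
    D (t • x + (1 - t) • y) = D y - t * ‖y - x‖ := by
  have hle (a b : F) : D a - D b ≤ ‖a - b‖ := by
    have := hD.dist_le_mul a b
    rw [Real.dist_eq, dist_eq_norm] at this
    simpa using (le_abs_self _).trans this
  have h1 := hle y (t • x + (1 - t) • y)
  have h2 := hle (t • x + (1 - t) • y) x
  rw [show y - (t • x + (1 - t) • y) = t • (y - x) by module, norm_smul, Real.norm_of_nonneg ht.1]
    at h1
  rw [show t • x + (1 - t) • y - x = (1 - t) • (y - x) by module, norm_smul,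
    Real.norm_of_nonneg (sub_nonneg.2 ht.2)] at h2
  linarith

/-- The gradient of a `1`-Lipschitz function along a segment on which it grows with slope `1`. -/
theorem LipschitzWith.gradient_eq_of_eq_norm_sub [CompleteSpace F] {D : F → ℝ}
    (hD : LipschitzWith 1 D) {x y : F} (hxy : x ≠ y) (h : D y - D x = ‖y - x‖) {t : ℝ}
    (ht : t ∈ Set.Icc (0 : ℝ) 1) (hdiff : DifferentiableAt ℝ D (t • x + (1 - t) • y)) :
    gradient D (t • x + (1 - t) • y) = ‖y - x‖⁻¹ • (y - x) := by
  set u := t • x + (1 - t) • y with hu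
  have hpos : 0 < ‖y - x‖ := norm_pos_iff.2 (sub_ne_zero.2 hxy.symm)
  have hline : HasDerivAt (fun s : ℝ => s • x + (1 - s) • y) (x - y) t := by
    have := ((hasDerivAt_id t).smul_const x).add
      (((hasDerivAt_id t).const_sub 1).smul_const y)
    rw [one_smul, neg_one_smul, ← sub_eq_add_neg] at this
    exact this
  -- Derivatives within `[0, 1]` cover the endpoints, beyond which `D` need not be affine.
  have h1 : HasDerivWithinAt (fun s : ℝ => D (s • x + (1 - s) • y)) (fderiv ℝ D u (x - y))
      (Set.Icc 0 1) t :=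
    (hdiff.hasFDerivAt.comp_hasDerivAt t hline).hasDerivWithinAt
  have h2 : HasDerivWithinAt (fun s : ℝ => D (s • x + (1 - s) • y)) (-‖y - x‖)
      (Set.Icc 0 1) t := by
    have : HasDerivWithinAt (fun s : ℝ => D y - s * ‖y - x‖) (-‖y - x‖) (Set.Icc 0 1) t := by
      simpa using ((hasDerivWithinAt_id t (Set.Icc (0 : ℝ) 1)).mul_const ‖y - x‖).const_sub (D y)
    exact this.congr (fun s hs => hD.eq_on_segment_of_eq_norm_sub h hs)
      (hD.eq_on_segment_of_eq_norm_sub h ht)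
  have h3 : fderiv ℝ D u (x - y) = -‖y - x‖ :=
    (uniqueDiffOn_Icc zero_lt_one t ht).eq_deriv _ h1 h2
  have hinner : inner ℝ (gradient D u) (y - x) = ‖y - x‖ := by
    rw [gradient, InnerProductSpace.toDual_symm_apply, ← neg_sub x y, map_neg, h3, neg_neg,
      neg_sub]
  have hnorm : ‖gradient D u‖ ≤ 1 := by
    rw [gradient, LinearIsometryEquiv.norm_map]
    simpa using norm_fderiv_le_of_lipschitz ℝ hD (x₀ := u)
  -- For the unit vector `e` on the right, `‖∇D - e‖² = ‖∇D‖² - 2 + 1 ≤ 0`.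
  rw [← sub_eq_zero, ← norm_eq_zero, ← sq_eq_zero_iff]
  refine le_antisymm ?_ (sq_nonneg _)
  rw [norm_sub_sq_real, inner_smul_right, hinner, norm_smul, norm_inv, norm_norm,
    inv_mul_cancel₀ hpos.ne']
  nlinarith [norm_nonneg (gradient D u)]

end Gradient

/-! ### Cyclical monotonicity of the support of an optimal plan -/

section OptimalPlan

variable {n : ℕ} {P Q : Measure (EuclideanSpace ℝ (Fin n))}
  {π : Measure (EuclideanSpace ℝ (Fin n) × EuclideanSpace ℝ (Fin n))}

lemma transportCost_add (μ ν : Measure (EuclideanSpace ℝ (Fin n) × EuclideanSpace ℝ (Fin n))) :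
    transportCost (μ + ν) = transportCost μ + transportCost ν :=
  lintegral_add_measure _ _ _

lemma transportCost_smul (a : ℝ≥0∞)
    (μ : Measure (EuclideanSpace ℝ (Fin n) × EuclideanSpace ℝ (Fin n))) :
    transportCost (a • μ) = a * transportCost μ :=
  lintegral_smul_measure _ _

lemma transportCost_sum {ι : Type*} (s : Finset ι)
    (μ : ι → Measure (EuclideanSpace ℝ (Fin n) × EuclideanSpace ℝ (Fin n))) :
    transportCost (∑ i ∈ s, μ i) = ∑ i ∈ s, transportCost (μ i) :=
  lintegral_finsetSum_measure _ _ _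

lemma transportCost_le_of_ae_le
    {μ : Measure (EuclideanSpace ℝ (Fin n) × EuclideanSpace ℝ (Fin n))} [IsProbabilityMeasure μ]
    {c : ℝ} (h : ∀ᵐ z ∂μ, ‖z.1 - z.2‖ ≤ c) : transportCost μ ≤ ENNReal.ofReal c := by
  refine (lintegral_mono_ae (h.mono fun z hz => ENNReal.ofReal_le_ofReal hz)).trans ?_
  simp

lemma le_transportCost_of_ae_le
    {μ : Measure (EuclideanSpace ℝ (Fin n) × EuclideanSpace ℝ (Fin n))} [IsProbabilityMeasure μ]
    {c : ℝ} (h : ∀ᵐ z ∂μ, c ≤ ‖z.1 - z.2‖) : ENNReal.ofReal c ≤ transportCost μ := by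
  refine le_trans ?_ (lintegral_mono_ae (h.mono fun z hz => ENNReal.ofReal_le_ofReal hz))
  simp

lemma abs_norm_sub_sub_norm_sub_le {E : Type*} [NormedAddCommGroup E] {x y a b : E} {r : ℝ}
    (hx : x ∈ Metric.ball a r) (hy : y ∈ Metric.ball b r) :
    |‖x - y‖ - ‖a - b‖| ≤ 2 * r := by
  rw [mem_ball_iff_norm] at hx hy
  refine (abs_norm_sub_norm_le _ _).trans ?_
  rw [show x - y - (a - b) = (x - a) - (y - b) by abel]
  linarith [norm_sub_le (x - a) (y - b)]

/-- A finite family of probability measures dominated by multiples of `π`, rearranged by a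
permutation of the second marginals, cannot lower the cost of an optimal plan. -/
lemma IsOptimalPlan.sum_transportCost_le [IsFiniteMeasure π] (hπ : IsOptimalPlan P Q π)
    (hfin : transportCost π ≠ ∞) {ι : Type*} [Fintype ι] (σ : Equiv.Perm ι)
    (ρ : ι → Measure (EuclideanSpace ℝ (Fin n) × EuclideanSpace ℝ (Fin n)))
    [∀ i, IsProbabilityMeasure (ρ i)] {a : ℝ≥0∞} (ha : a ≠ 0) (ha' : a ≠ ∞)
    (hle : a • ∑ i, ρ i ≤ π) :
    ∑ i, transportCost (ρ i) ≤ ∑ i, transportCost ((ρ i).fst.prod (ρ (σ i)).snd) := by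
  set η := a • ∑ i, ρ i with hη
  have : IsFiniteMeasure η := isFiniteMeasure_of_le π hle
  set τ := π - η
  have hτ : τ + η = π := Measure.sub_add_cancel_of_le hle
  -- Only marginals matter for admissibility, so independent couplings suffice for the exchange.
  set η' := a • ∑ i, (ρ i).fst.prod (ρ (σ i)).snd with hη'
  have hfst : η'.map Prod.fst = η.map Prod.fst := by
    simp only [hη', hη, Measure.map_smul, Measure.map_finset_sum' measurable_fst.aemeasurable]
    congr 1
    exact Finset.sum_congr rfl fun i _ => Measure.fst_prod
  have hsnd : η'.map Prod.snd = η.map Prod.snd := by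
    simp only [hη', hη, Measure.map_smul, Measure.map_finset_sum' measurable_snd.aemeasurable]
    congr 1
    rw [← Equiv.sum_comp σ fun i => (ρ i).map Prod.snd]
    exact Finset.sum_congr rfl fun i _ => Measure.snd_prod
  have hmem : τ + η' ∈ transportPlans P Q := by
    obtain ⟨h1, h2⟩ := hπ.1
    rw [← hτ] at h1 h2
    constructor
    · rw [Measure.map_add _ _ measurable_fst, hfst, ← Measure.map_add _ _ measurable_fst, h1]
    · rw [Measure.map_add _ _ measurable_snd, hsnd, ← Measure.map_add _ _ measurable_snd, h2]
  have hopt : transportCost π ≤ transportCost (τ + η') := by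
    rw [hπ.2]
    exact iInf₂_le _ hmem
  rw [← hτ, transportCost_add] at hfin
  rw [← hτ, transportCost_add, transportCost_add,
    ENNReal.add_le_add_iff_left (ENNReal.add_ne_top.1 hfin).1, hη, hη', transportCost_smul,
    transportCost_smul, ENNReal.mul_le_mul_iff_right ha ha', transportCost_sum,
    transportCost_sum] at hopt
  exact hopt

/-- Small enough multiples of conditional laws are jointly dominated by the measure. -/
lemma exists_smul_sum_cond_le {Ω : Type*} [MeasurableSpace Ω] (μ : Measure Ω) [IsFiniteMeasure μ]
    {ι : Type*} [Fintype ι] (B : ι → Set Ω) (hB : ∀ i, μ (B i) ≠ 0) :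
    ∃ a : ℝ≥0∞, a ≠ 0 ∧ a ≠ ∞ ∧ a • ∑ i, μ[|B i] ≤ μ := by
  cases isEmpty_or_nonempty ι
  · exact ⟨1, one_ne_zero, ENNReal.one_ne_top, by simpa using Measure.zero_le μ⟩
  obtain ⟨j, -, hj⟩ := Finset.exists_min_image Finset.univ (fun i => μ (B i)) Finset.univ_nonempty
  have hcard : (Fintype.card ι : ℝ≥0∞) ≠ 0 := by simp
  -- With the smallest mass as numerator, each summand is at most `μ / card ι`.
  refine ⟨μ (B j) / Fintype.card ι, ?_, ?_, ?_⟩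
  · exact ENNReal.div_ne_zero.2 ⟨hB j, ENNReal.natCast_ne_top _⟩
  · exact ENNReal.div_ne_top (measure_ne_top _ _) hcard
  refine Measure.le_iff.2 fun s _ => ?_
  rw [Measure.smul_apply, Measure.finsetSum_apply, smul_eq_mul, Finset.mul_sum]
  have hi (i : ι) : μ (B j) / Fintype.card ι * μ[|B i] s ≤ (Fintype.card ι : ℝ≥0∞)⁻¹ * μ s := by
    have h1 : μ[|B i] s ≤ (μ (B i))⁻¹ * μ s := by
      rw [ProbabilityTheory.cond, Measure.smul_apply, smul_eq_mul]
      gcongr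
      exact Measure.restrict_le_self
    calc μ (B j) / Fintype.card ι * μ[|B i] s
        ≤ μ (B i) / Fintype.card ι * ((μ (B i))⁻¹ * μ s) := by
          gcongr ?_ / _ * ?_
          exact hj i (Finset.mem_univ i)
      _ = (μ (B i) * (μ (B i))⁻¹) * ((Fintype.card ι : ℝ≥0∞)⁻¹ * μ s) := by
          rw [div_eq_mul_inv]
          ring
      _ = _ := by rw [ENNReal.mul_inv_cancel (hB i) (measure_ne_top _ _), one_mul]
  refine (Finset.sum_le_sum fun i _ => hi i).trans ?_
  rw [Finset.sum_const, Finset.card_univ, nsmul_eq_mul, ← mul_assoc,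
    ENNReal.mul_inv_cancel hcard (ENNReal.natCast_ne_top _), one_mul]

/-- Balls around support points have positive mass, so `π` conditioned on them can be exchanged;
costs there differ from those at the centres by at most `2 * r`. -/
theorem IsOptimalPlan.isCyclicallyMonotone_support [IsFiniteMeasure π]
    (hπ : IsOptimalPlan P Q π) (hfin : transportCost π ≠ ∞) :
    IsCyclicallyMonotone π.support := by
  intro N p σ hp
  refine le_of_forall_pos_le_add fun ε hε => ?_
  set r : ℝ := ε / (4 * (N + 1)) with hr
  have hrpos : 0 < r := by positivity
  have hrN : (N : ℝ) * (4 * r) ≤ ε := by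
    have : ((N : ℝ) + 1) * (4 * r) = ε := by rw [hr]; field_simp
    nlinarith
  set B : Fin N → Set (EuclideanSpace ℝ (Fin n) × EuclideanSpace ℝ (Fin n)) :=
    fun i => Metric.ball (p i).1 r ×ˢ Metric.ball (p i).2 r
  have hBm (i) : MeasurableSet (B i) :=
    Metric.isOpen_ball.measurableSet.prod Metric.isOpen_ball.measurableSet
  have hB (i) : π (B i) ≠ 0 :=
    ((Measure.mem_support_iff_forall _).1 (hp i) _
      (prod_mem_nhds (Metric.ball_mem_nhds _ hrpos) (Metric.ball_mem_nhds _ hrpos))).ne'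
  have hprob (i) : IsProbabilityMeasure π[|B i] := cond_isProbabilityMeasure (hB i)
  have hmem (i) : ∀ᵐ z ∂π[|B i], z ∈ B i := ae_cond_mem (hBm i)
  obtain ⟨a, ha, ha', hle⟩ := exists_smul_sum_cond_le π B hB
  have key := hπ.sum_transportCost_le hfin σ (fun i => π[|B i]) ha ha' hle
  have hlow (i) : ENNReal.ofReal (‖(p i).1 - (p i).2‖ - 2 * r) ≤ transportCost π[|B i] := by
    refine le_transportCost_of_ae_le ((hmem i).mono fun z hz => ?_)
    linarith [(abs_le.1 (abs_norm_sub_sub_norm_sub_le hz.1 hz.2)).1]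
  have hup (i) : transportCost ((π[|B i]).fst.prod (π[|B (σ i)]).snd) ≤
      ENNReal.ofReal (‖(p i).1 - (p (σ i)).2‖ + 2 * r) := by
    have h1 : ∀ᵐ x ∂(π[|B i]).fst, x ∈ Metric.ball (p i).1 r :=
      (ae_map_iff measurable_fst.aemeasurable Metric.isOpen_ball.measurableSet).2
        ((hmem i).mono fun z hz => hz.1)
    have h2 : ∀ᵐ y ∂(π[|B (σ i)]).snd, y ∈ Metric.ball (p (σ i)).2 r :=
      (ae_map_iff measurable_snd.aemeasurable Metric.isOpen_ball.measurableSet).2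
        ((hmem (σ i)).mono fun z hz => hz.2)
    refine transportCost_le_of_ae_le ?_
    filter_upwards [Measure.quasiMeasurePreserving_fst.ae h1,
      Measure.quasiMeasurePreserving_snd.ae h2] with z hz1 hz2
    linarith [(abs_le.1 (abs_norm_sub_sub_norm_sub_le hz1 hz2)).2]
  have h := (Finset.sum_le_sum fun i _ => hlow i).trans
    (key.trans (Finset.sum_le_sum fun i _ => hup i))
  rw [← ENNReal.ofReal_sum_of_nonneg (f := fun i => ‖(p i).1 - (p (σ i)).2‖ + 2 * r)
    (fun i _ => by positivity)] at h
  -- The lower bounds may be negative, where `ENNReal.ofReal` truncates to `0`; its subadditivity is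
  -- enough on this side.
  have h' : ∑ i, (‖(p i).1 - (p i).2‖ - 2 * r) ≤ ∑ i, (‖(p i).1 - (p (σ i)).2‖ + 2 * r) := by
    rw [← ENNReal.ofReal_le_ofReal_iff (Finset.sum_nonneg fun i _ => by positivity)]
    refine le_trans ?_ h
    clear h key hlow hup
    induction (Finset.univ : Finset (Fin N)) using Finset.induction_on with
    | empty => simp
    | insert i s hi ih =>
      rw [Finset.sum_insert hi, Finset.sum_insert hi]
      exact ENNReal.ofReal_add_le.trans (by gcongr)
  rw [Finset.sum_sub_distrib, Finset.sum_add_distrib] at h'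
  simp only [Finset.sum_const, Finset.card_univ, Fintype.card_fin, nsmul_eq_mul] at h'
  linarith

end OptimalPlan

/-! ### Strong duality and complementary slackness -/

section Duality

variable {n : ℕ} {P Q : Measure (EuclideanSpace ℝ (Fin n))}
  {π : Measure (EuclideanSpace ℝ (Fin n) × EuclideanSpace ℝ (Fin n))}

lemma integrable_sub_of_mem_admissibleCritics (hπ : π ∈ transportPlans P Q)
    {f : EuclideanSpace ℝ (Fin n) → ℝ} (hf : f ∈ admissibleCritics P Q) :
    Integrable (fun z => f z.2 - f z.1) π := by
  obtain ⟨-, hP, hQ⟩ := hf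
  rw [← hπ.1] at hP
  rw [← hπ.2] at hQ
  exact (hQ.comp_measurable measurable_snd).sub (hP.comp_measurable measurable_fst)

lemma criticObjective_eq_integral (hπ : π ∈ transportPlans P Q)
    {f : EuclideanSpace ℝ (Fin n) → ℝ} (hf : f ∈ admissibleCritics P Q) :
    criticObjective P Q f = ∫ z, (f z.2 - f z.1) ∂π := by
  obtain ⟨hlip, hP, hQ⟩ := hf
  rw [← hπ.1] at hP
  rw [← hπ.2] at hQ
  have h : ∫ z, (f z.2 - f z.1) ∂π = (∫ z, f z.2 ∂π) - ∫ z, f z.1 ∂π :=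
    integral_sub (hQ.comp_measurable measurable_snd) (hP.comp_measurable measurable_fst)
  rw [h, criticObjective, ← hπ.1, ← hπ.2,
    integral_map measurable_snd.aemeasurable hlip.continuous.aestronglyMeasurable,
    integral_map measurable_fst.aemeasurable hlip.continuous.aestronglyMeasurable]

/-- The potential itself may fail to be integrable; bounded truncations are integrable and stay
1-Lipschitz. -/
lemma LipschitzWith.truncate_mem_admissibleCritics [IsFiniteMeasure P] [IsFiniteMeasure Q]
    {φ : EuclideanSpace ℝ (Fin n) → ℝ} (hφ : LipschitzWith 1 φ) (k : ℕ) :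
    (fun x => max (-(k : ℝ)) (min (φ x) k)) ∈ admissibleCritics P Q := by
  have hlip : LipschitzWith 1 fun x => max (-(k : ℝ)) (min (φ x) k) :=
    (hφ.min_const _).const_max _
  have hint (μ : Measure (EuclideanSpace ℝ (Fin n))) [IsFiniteMeasure μ] :
      Integrable (fun x => max (-(k : ℝ)) (min (φ x) k)) μ := by
    refine Integrable.of_bound hlip.continuous.aestronglyMeasurable (k : ℝ)
      (Eventually.of_forall fun x => ?_)
    rw [Real.norm_eq_abs, abs_le]
    exact ⟨le_max_left _ _, max_le (by linarith [k.cast_nonneg (α := ℝ)]) (min_le_right _ _)⟩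
  exact ⟨hlip, hint P, hint Q⟩

lemma LipschitzWith.abs_sub_le_norm_sub {f : EuclideanSpace ℝ (Fin n) → ℝ}
    (hf : LipschitzWith 1 f) (x y : EuclideanSpace ℝ (Fin n)) : |f y - f x| ≤ ‖x - y‖ := by
  have := hf.dist_le_mul y x
  rw [Real.dist_eq, dist_eq_norm, norm_sub_rev] at this
  simpa using this

lemma integrable_norm_sub_of_transportCost_ne_top (hfin : transportCost π ≠ ∞) :
    Integrable (fun z => ‖z.1 - z.2‖) π := by
  refine ⟨by fun_prop, ?_⟩
  rw [hasFiniteIntegral_iff_ofReal (Eventually.of_forall fun z => norm_nonneg _)]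
  exact lt_top_iff_ne_top.2 hfin

/-- The dual value of an optimal critic is at least the cost of an optimal plan. -/
theorem IsOptimalCritic.integral_norm_sub_le [IsProbabilityMeasure P] [IsProbabilityMeasure Q]
    [IsProbabilityMeasure π] (hπ : IsOptimalPlan P Q π) (hfin : transportCost π ≠ ∞)
    {D : EuclideanSpace ℝ (Fin n) → ℝ} (hD : IsOptimalCritic P Q D) :
    ∫ z, ‖z.1 - z.2‖ ∂π ≤ ∫ z, (D z.2 - D z.1) ∂π := by
  obtain ⟨φ, hφ, hS⟩ := (hπ.isCyclicallyMonotone_support hfin).exists_potential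
    (Measure.nonempty_support (IsProbabilityMeasure.ne_zero π))
  have hae : ∀ᵐ z ∂π, φ z.2 - φ z.1 = ‖z.1 - z.2‖ :=
    mem_of_superset Measure.support_mem_ae hS
  set T : ℕ → EuclideanSpace ℝ (Fin n) → ℝ := fun k x => max (-(k : ℝ)) (min (φ x) k) with hT
  have hTmem (k) : T k ∈ admissibleCritics P Q := hφ.truncate_mem_admissibleCritics k
  have hTlim (x) : Tendsto (fun k => T k x) atTop (𝓝 (φ x)) := by
    -- Truncation has no effect once `k ≥ |φ x|`.
    refine tendsto_const_nhds.congr' ?_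
    filter_upwards [eventually_ge_atTop ⌈|φ x|⌉₊] with k hk
    have hk' := abs_le.1 (Nat.ceil_le.1 hk)
    simp [hT, hk'.1, hk'.2]
  have hlim : Tendsto (fun k => ∫ z, (T k z.2 - T k z.1) ∂π) atTop
      (𝓝 (∫ z, ‖z.1 - z.2‖ ∂π)) := by
    refine tendsto_integral_of_dominated_convergence (fun z => ‖z.1 - z.2‖)
      (fun k => (integrable_sub_of_mem_admissibleCritics hπ.1 (hTmem k)).aestronglyMeasurable)
      (integrable_norm_sub_of_transportCost_ne_top hfin)
      (fun k => Eventually.of_forall fun z => (hTmem k).1.abs_sub_le_norm_sub z.1 z.2) ?_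
    filter_upwards [hae] with z hz
    rw [← hz]
    exact (hTlim z.2).sub (hTlim z.1)
  refine le_of_tendsto' hlim fun k => ?_
  rw [← criticObjective_eq_integral hπ.1 (hTmem k), ← criticObjective_eq_integral hπ.1 hD.1]
  exact hD.2 _ (hTmem k)

/-- Complementary slackness: an optimal critic has slope `1` along almost every transported
pair. -/
theorem IsOptimalCritic.ae_sub_eq_norm_sub [IsProbabilityMeasure P] [IsProbabilityMeasure Q]
    [IsProbabilityMeasure π] (hπ : IsOptimalPlan P Q π) (hfin : transportCost π ≠ ∞)
    {D : EuclideanSpace ℝ (Fin n) → ℝ} (hD : IsOptimalCritic P Q D) :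
    ∀ᵐ z ∂π, D z.2 - D z.1 = ‖z.1 - z.2‖ := by
  have hcost := integrable_norm_sub_of_transportCost_ne_top hfin
  have hint := integrable_sub_of_mem_admissibleCritics hπ.1 hD.1
  have hle : ∀ z : EuclideanSpace ℝ (Fin n) × EuclideanSpace ℝ (Fin n),
      D z.2 - D z.1 ≤ ‖z.1 - z.2‖ :=
    fun z => (le_abs_self _).trans (hD.1.1.abs_sub_le_norm_sub z.1 z.2)
  exact (integral_eq_iff_of_ae_le hint hcost (Eventually.of_forall hle)).1
    (le_antisymm (integral_mono hint hcost hle) (hD.integral_norm_sub_le hπ hfin))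

end Duality

theorem theorem2 {n : ℕ} (P Q : Measure (EuclideanSpace ℝ (Fin n)))
    [IsProbabilityMeasure P] [IsProbabilityMeasure Q]
    (hW : wassersteinOne P Q ≠ ∞)
    (π : Measure (EuclideanSpace ℝ (Fin n) × EuclideanSpace ℝ (Fin n)))
    (hπ : IsOptimalPlan P Q π)
    (hdiag : π {z | z.1 = z.2} = 0)
    (D : EuclideanSpace ℝ (Fin n) → ℝ)
    (hD : IsOptimalCritic P Q D)
    (hdiff : Differentiable ℝ D) :
    ∀ᵐ z ∂π, ∀ t ∈ Set.Icc (0 : ℝ) 1,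
      gradient D (t • z.1 + (1 - t) • z.2) = ‖z.2 - z.1‖⁻¹ • (z.2 - z.1) := by
  have : IsProbabilityMeasure π := by
    have h : π Set.univ = P Set.univ := by
      rw [← hπ.1.1, Measure.map_apply measurable_fst MeasurableSet.univ, Set.preimage_univ]
    exact ⟨h.trans measure_univ⟩
  have hfin : transportCost π ≠ ∞ := hπ.2 ▸ hW
  have hne : ∀ᵐ z ∂π, z.1 ≠ z.2 := by
    rw [ae_iff]
    simpa using hdiag
  filter_upwards [hD.ae_sub_eq_norm_sub hπ hfin, hne] with z hz hz' t ht
  rw [norm_sub_rev] at hz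
  exact hD.1.1.gradient_eq_of_eq_norm_sub hz' hz ht (hdiff _)
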